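/- **Conservation of the pre-scattering condition.** Let $X$ be a smooth manifold (without boundary, not necessarily compact) of dimension $n$, oriented by a smooth volume form $\Omega>0$, and let $\mathcal M$ be the set of smooth Riemannian metrics on $X$. For $g\in\mathcal M$ let $\nabla_g$ be the Levi-Civita connection and $\mathcal R_g(\xi,\eta)=\nabla_{g,\xi}\nabla_{g,\eta}-\nabla_{g,\eta}\nabla_{g,\xi}-\nabla_{g,[\xi,\eta]}$ its curvature. For a smooth symmetric $2$-tensor $v$ let $v^*_g:=g^{-1}v\in C^\infty(X,\mathrm{End}(T_X))$, and for $H\in C^\infty(X,\mathrm{End}(T_X))$ let $(\nabla_{T_X,g}H)(\xi,\eta):=(\nabla_{g,\xi}H)\eta-(\nabla_{g,\eta}H)\xi$ be the covariant exterior derivative of $H$ seen as a $T_X$-valued $1$-form. The $\Omega$-Bakry-Emery-Ricci tensor is $$\mathrm{Ric}_g(\Omega):=\mathrm{Ric}(g)+\nabla_g\,d\log\frac{dV_g}{\Omega},\qquad \mathrm{Ric}^*_g(\Omega):=g^{-1}\mathrm{Ric}_g(\Omega).$$ Define $$\mathbb F_g:=\{v\in C^\infty(X,S^2T^*_X)\mid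 \nabla_{T_X,g}v^*_g=0\},$$ $$\mathbb E_g:=\{v\in C^\infty(X,S^2T^*_X)\mid [\mathcal R_g(\xi,\eta),v^*_g]=0,\ [\mathcal R_g(\xi,\eta),\nabla_{g,\mu}v^*_g]=0\ \text{ for all } x\in X,\ \xi,\eta,\mu\in T_{X,x}\},$$ $$\mathcal S_\Omega:=\{g\in\mathcal M\mid \nabla_{T_X,g}\mathrm{Ric}^*_g(\Omega)=0\}.$$ Let $(g_t)_{t\in\mathbb R}\subset\mathcal M$ be a smooth family (smooth jointly in $t$ and the point of $X$) such that $\dot g_t:=\frac{d}{dt}g_t\in\mathbb F_{g_t}\cap\mathbb E_{g_t}$ for all $t\in\mathbb R$. If $g_0\in\mathcal S_\Omega$, then $g_t\in\mathcal S_\Omega$ for all $t\in\mathbb R$. -/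

import Mathlib

open scoped Manifold ContDiff

noncomputable section

namespace PreScattering

/-- The model space of an `n`-dimensional manifold. -/
abbrev Model (n : ℕ) : Type := EuclideanSpace ℝ (Fin n)

/-! ### Tensor calculus in one coordinate chart

Below `G : Model n → Matrix (Fin n) (Fin n) ℝ` is the matrix `(g_ij)` of a metric in a chart, as a
function of the coordinates. An endomorphism field `H` of the tangent bundle is represented by the
matrix function with entries `H a b = H^a_b`, that is `H ∂_b = ∑ a, H^a_b ∂_a`, so that
composition of endomorphisms is matrix multiplication. -/

section Chart

variable {n : ℕ}

/-- The partial derivative `∂_i u` of a function of the coordinates. -/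
def partialDeriv (i : Fin n) (u : Model n → ℝ) (y : Model n) : ℝ :=
  fderiv ℝ u y (EuclideanSpace.single i 1)

/-- The entrywise partial derivative `∂_i A` of a matrix function of the coordinates. -/
def partialMatrix (i : Fin n) (A : Model n → Matrix (Fin n) (Fin n) ℝ) (y : Model n) :
    Matrix (Fin n) (Fin n) ℝ :=
  Matrix.of fun a b => partialDeriv i (fun z => A z a b) y

/-- The matrix of the Levi-Civita connection in the direction `∂_i`; its entry `k, j` is the
Christoffel symbol `Γ^k_ij = 1/2 ∑ l, g^kl (∂_i g_jl + ∂_j g_il - ∂_l g_ij)`, so that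
`∇_{∂_i} ∂_j = ∑ k, Γ^k_ij ∂_k`. -/
def christoffel (G : Model n → Matrix (Fin n) (Fin n) ℝ) (i : Fin n) (y : Model n) :
    Matrix (Fin n) (Fin n) ℝ :=
  Matrix.of fun k j => (1 / 2 : ℝ) * ∑ l, (G y)⁻¹ k l *
    (partialDeriv i (fun z => G z j l) y + partialDeriv j (fun z => G z i l) y
      - partialDeriv l (fun z => G z i j) y)

/-- The covariant derivative `∇_{∂_i} H` of an endomorphism field `H`. -/
def covEnd (G : Model n → Matrix (Fin n) (Fin n) ℝ) (i : Fin n)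
    (H : Model n → Matrix (Fin n) (Fin n) ℝ) (y : Model n) : Matrix (Fin n) (Fin n) ℝ :=
  partialMatrix i H y + ⁅christoffel G i y, H y⁆

/-- The covariant exterior derivative of an endomorphism field `H`, regarded as a `1`-form with
values in the tangent bundle:
`(∇_{T_X} H) (∂_i, ∂_j) = (∇_{∂_i} H) ∂_j - (∇_{∂_j} H) ∂_i`, as a vector of components. -/
def extCovDeriv (G : Model n → Matrix (Fin n) (Fin n) ℝ)
    (H : Model n → Matrix (Fin n) (Fin n) ℝ) (y : Model n) (i j : Fin n) : Fin n → ℝ :=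
  fun k => covEnd G i H y k j - covEnd G j H y k i

/-- The curvature endomorphism
`R(∂_i, ∂_j) = ∇_{∂_i} ∇_{∂_j} - ∇_{∂_j} ∇_{∂_i}`. -/
def curvature (G : Model n → Matrix (Fin n) (Fin n) ℝ) (i j : Fin n) (y : Model n) :
    Matrix (Fin n) (Fin n) ℝ :=
  partialMatrix i (christoffel G j) y - partialMatrix j (christoffel G i) y
    + ⁅christoffel G i y, christoffel G j y⁆

/-- The Ricci tensor `Ric(∂_j, ∂_k) = tr (ξ ↦ R(ξ, ∂_j) ∂_k)`. -/
def ricci (G : Model n → Matrix (Fin n) (Fin n) ℝ) (y : Model n) : Matrix (Fin n) (Fin n) ℝ :=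
  Matrix.of fun j k => ∑ i, curvature G i j y i k

/-- The Hessian `∇ d u (∂_i, ∂_j) = ∂_i ∂_j u - ∑ k, Γ^k_ij ∂_k u`. -/
def hessian (G : Model n → Matrix (Fin n) (Fin n) ℝ) (u : Model n → ℝ) (y : Model n) :
    Matrix (Fin n) (Fin n) ℝ :=
  Matrix.of fun i j => partialDeriv i (partialDeriv j u) y
    - ∑ k, christoffel G i y k j * partialDeriv k u y

/-- The function `f = log (dV_g / Ω)`, where `w = Ω(∂_1, …, ∂_n)`. The manifold is oriented
by `Ω`, so `dV_g / Ω = √(det (g_ij)) / |w|` in every chart, positively oriented or not. -/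
def logDensity (G : Model n → Matrix (Fin n) (Fin n) ℝ) (w : Model n → ℝ) (y : Model n) : ℝ :=
  Real.log (Real.sqrt (G y).det / |w y|)

/-- The Bakry-Emery-Ricci tensor `Ric_g(Ω) = Ric(g) + ∇_g d log (dV_g / Ω)`. -/
def bakryEmeryRicci (G : Model n → Matrix (Fin n) (Fin n) ℝ) (w : Model n → ℝ) (y : Model n) :
    Matrix (Fin n) (Fin n) ℝ :=
  ricci G y + hessian G (logDensity G w) y

/-- The endomorphism field `v* = g⁻¹ v` of a symmetric `2`-tensor `v`. -/
def raise (G v : Model n → Matrix (Fin n) (Fin n) ℝ) (y : Model n) : Matrix (Fin n) (Fin n) ℝ :=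
  (G y)⁻¹ * v y

end Chart

/-! ### Global objects on a smooth manifold -/

section Manifold

variable {n : ℕ} (X : Type*) [TopologicalSpace X] [ChartedSpace (Model n) X]

/-- The smooth coordinate charts of `X`. -/
abbrev charts : Set (OpenPartialHomeomorph X (Model n)) :=
  IsManifold.maximalAtlas (𝓡 n) ∞ X

variable {X}

/-- The coordinate vector field `∂_i` of the chart `e`, at the point with coordinates `y`. -/
def frame (e : OpenPartialHomeomorph X (Model n)) (y : Model n) (i : Fin n) :
    TangentSpace (𝓡 n) (e.symm y) :=
  mfderiv (𝓡 n) (𝓡 n) e.symm y (EuclideanSpace.single i (1 : ℝ) : Model n)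

/-- The components `b(∂_i, ∂_j)` of a field of bilinear forms in the chart `e`. -/
def components
    (b : ∀ x : X, TangentSpace (𝓡 n) x →L[ℝ] TangentSpace (𝓡 n) x →L[ℝ] ℝ)
    (e : OpenPartialHomeomorph X (Model n)) (y : Model n) : Matrix (Fin n) (Fin n) ℝ :=
  Matrix.of fun i j => b (e.symm y) (frame e y i) (frame e y j)

variable (X)

/-- Smooth volume forms: nowhere vanishing smooth forms of top degree. The manifold carries the
orientation for which the form is positive. -/
structure VolumeForm where
  /-- The alternating form on every tangent space. -/
  form : ∀ x : X, (TangentSpace (𝓡 n) x) [⋀^Fin n]→L[ℝ] ℝ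
  ne_zero : ∀ x, form x ≠ 0
  smooth : ∀ e ∈ charts X,
    ContDiffOn ℝ ∞ (fun y => form (e.symm y) (frame e y)) e.target

variable [IsManifold (𝓡 n) ∞ X]

/-- The space of smooth Riemannian metrics on `X`. -/
abbrev Metric : Type _ :=
  Bundle.ContMDiffRiemannianMetric (𝓡 n) ∞ (Model n) (fun x : X => TangentSpace (𝓡 n) x)

/-- Smooth fields of symmetric bilinear forms, `C^∞(X, S² T*X)`. -/
structure SymForm where
  /-- The bilinear form on every tangent space. -/
  form : ∀ x : X, TangentSpace (𝓡 n) x →L[ℝ] TangentSpace (𝓡 n) x →L[ℝ] ℝ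
  symm : ∀ (x : X) (u w : TangentSpace (𝓡 n) x), form x u w = form x w u
  smooth : ContMDiff (𝓡 n) ((𝓡 n).prod 𝓘(ℝ, Model n →L[ℝ] Model n →L[ℝ] ℝ)) ∞
    (fun x => Bundle.TotalSpace.mk' (Model n →L[ℝ] Model n →L[ℝ] ℝ) x (form x))

variable {X}

/-- The component of a volume form in the chart `e`, that is `Ω(∂_1, …, ∂_n)`. -/
def VolumeForm.component (Ω : VolumeForm (n := n) X) (e : OpenPartialHomeomorph X (Model n))
    (y : Model n) : ℝ :=
  Ω.form (e.symm y) (frame e y)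

/-- The matrix `(g_ij)` of a metric in the chart `e`. -/
def metricMatrix (g : Metric (n := n) X) (e : OpenPartialHomeomorph X (Model n)) :
    Model n → Matrix (Fin n) (Fin n) ℝ :=
  components g.inner e

/-- The endomorphism field `v* = g⁻¹ v` in the chart `e`. -/
def dualEnd (g : Metric (n := n) X) (v : SymForm (n := n) X)
    (e : OpenPartialHomeomorph X (Model n)) : Model n → Matrix (Fin n) (Fin n) ℝ :=
  raise (metricMatrix g e) (components v.form e)

/-- The space `𝔽_g` of smooth symmetric `2`-tensors `v` with `∇_{T_X, g} v* = 0`. -/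
def spaceF (g : Metric (n := n) X) : Set (SymForm (n := n) X) :=
  {v | ∀ e ∈ charts X, ∀ y ∈ e.target, ∀ i j : Fin n,
    extCovDeriv (metricMatrix g e) (dualEnd g v e) y i j = 0}

/-- The space `𝔼_g` of smooth symmetric `2`-tensors `v` with `[R_g, v*] = 0` and
`[R_g, ∇_{g, ξ} v*] = 0` for all tangent vectors `ξ`. -/
def spaceE (g : Metric (n := n) X) : Set (SymForm (n := n) X) :=
  {v | ∀ e ∈ charts X, ∀ y ∈ e.target, ∀ i j : Fin n,
    ⁅curvature (metricMatrix g e) i j y, dualEnd g v e y⁆ = 0 ∧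
    ∀ k : Fin n,
      ⁅curvature (metricMatrix g e) i j y, covEnd (metricMatrix g e) k (dualEnd g v e) y⁆ = 0}

/-- The set `𝓢_Ω` of pre-scattering data: the metrics `g` with `∇_{T_X, g} Ric*_g(Ω) = 0`. -/
def preScattering (Ω : VolumeForm (n := n) X) : Set (Metric (n := n) X) :=
  {g | ∀ e ∈ charts X, ∀ y ∈ e.target, ∀ i j : Fin n,
    extCovDeriv (metricMatrix g e)
      (raise (metricMatrix g e) (bakryEmeryRicci (metricMatrix g e) (Ω.component e))) y i j = 0}

/-- A family of metrics is smooth if in every chart its components are smooth functions of the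
time and the coordinates jointly. -/
def IsSmoothFamily (g : ℝ → Metric (n := n) X) : Prop :=
  ∀ e ∈ charts X, ∀ i j : Fin n,
    ContDiffOn ℝ ∞ (fun p : ℝ × Model n => metricMatrix (g p.1) e p.2 i j)
      (Set.univ ×ˢ e.target)

/-- `v t` is the time derivative of `g t`, for all `t`. -/
def IsVariation (g : ℝ → Metric (n := n) X) (v : ℝ → SymForm (n := n) X) : Prop :=
  ∀ (t : ℝ) (x : X) (u w : TangentSpace (𝓡 n) x),
    HasDerivAt (fun s => (g s).inner x u w) ((v t).form x u w) t

end Manifold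

end PreScattering

end

open PreScattering

/-! The claim is local, so it is proved in one chart, over the ring of smooth functions on (time) ×
(chart domain), where the $\partial_i$ and $\partial_t$ are commuting derivations and the tensor
calculus becomes matrix algebra. Write $H = g^{-1}\dot g$, $f = \log(dV_g/\Omega)$ and $B =
\mathrm{Ric}^*_g(\Omega)$.

Since $\dot g\in\mathbb F_g$, the tensor $g(\nabla H\cdot,\cdot)$ is totally symmetric, and the
formula for the varied connection collapses to $2\dot\Gamma = \nabla H$ (`two_mder_dt_Γ`). Hence
$2\dot{\mathcal R}(\partial_i,\partial_j) = [\nabla_i,\nabla_j]H = [\mathcal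
R(\partial_i,\partial_j),H] = 0$ by the first condition of $\mathbb E_g$, so the Ricci tensor is
constant in time. As $2\dot f = \mathrm{tr}\,H$, only the Hessian of $f$ varies, which gives $2\dot
B = \Delta H - \nabla_{\mathrm{grad} f}H - 2HB$ (`two_mder_dt_ber`).

Now apply $\nabla_{T_X}$. With the second condition of $\mathbb E_g$, commuting derivatives in
$\Delta H$ leaves only a Ricci term (`ext_lap`), and the drift leaves only a Hessian term
(`ext_drift`); together they give $\nabla_iH\,B\partial_j - \nabla_jH\,B\partial_i$. Leibniz on
$-2HB$ contributes $-2$ times this expression, and the variation of the connection in $\nabla_{T_X}$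
contributes it once more. The sum is zero, so $\partial_t(\nabla_{T_X}B) = -H\,\nabla_{T_X}B$.
Because $\dot g = gH$, the lowered tensor $g\,\nabla_{T_X}B$ is constant in time; it vanishes at
time $0$, hence always. -/

noncomputable section

namespace PreScattering

/-! ### Derivations acting on matrices -/

section MatrixDerivation

variable {S : Type*} [CommRing S] [Algebra ℝ S] {ι : Type*}

/-- The entrywise action of a derivation on a matrix. -/
def mder (δ : Derivation ℝ S S) (A : Matrix ι ι S) : Matrix ι ι S := A.map δ

@[simp] lemma mder_apply (δ : Derivation ℝ S S) (A : Matrix ι ι S) (a b : ι) :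
    mder δ A a b = δ (A a b) := rfl

lemma mder_add (δ : Derivation ℝ S S) (A B : Matrix ι ι S) :
    mder δ (A + B) = mder δ A + mder δ B := by ext; simp

lemma mder_sub (δ : Derivation ℝ S S) (A B : Matrix ι ι S) :
    mder δ (A - B) = mder δ A - mder δ B := by ext; simp

lemma mder_transpose (δ : Derivation ℝ S S) (A : Matrix ι ι S) :
    mder δ A.transpose = (mder δ A).transpose := rfl

lemma mder_smul (δ : Derivation ℝ S S) (s : S) (A : Matrix ι ι S) :
    mder δ (s • A) = s • mder δ A + δ s • A := by
  ext; simp; ring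

lemma mder_sum {κ : Type*} (δ : Derivation ℝ S S) (s : Finset κ) (A : κ → Matrix ι ι S) :
    mder δ (∑ k ∈ s, A k) = ∑ k ∈ s, mder δ (A k) := by
  ext; simp [Matrix.sum_apply]

lemma mder_comm {δ δ' : Derivation ℝ S S} (h : ∀ a, δ (δ' a) = δ' (δ a)) (A : Matrix ι ι S) :
    mder δ (mder δ' A) = mder δ' (mder δ A) := by ext; simp [h]

lemma mder_one [DecidableEq ι] (δ : Derivation ℝ S S) : mder δ (1 : Matrix ι ι S) = 0 := by
  ext a b; by_cases h : a = b <;> simp [h]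

variable [Fintype ι]

lemma mder_mul (δ : Derivation ℝ S S) (A B : Matrix ι ι S) :
    mder δ (A * B) = mder δ A * B + A * mder δ B := by
  ext; simp [Matrix.mul_apply, Finset.sum_add_distrib]
  rw [add_comm]; congr 1; exact Finset.sum_congr rfl fun _ _ => mul_comm _ _

variable [DecidableEq ι]

/-- The derivative of an inverse matrix. -/
lemma mder_inv (δ : Derivation ℝ S S) {A B : Matrix ι ι S} (h : A * B = 1) :
    mder δ B = -(B * mder δ A * B) := by
  have h' : B * A = 1 := mul_eq_one_comm.mp h
  have := mder_mul δ A B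
  rw [h, mder_one] at this
  have h2 : A * mder δ B = -(mder δ A * B) := (neg_eq_of_add_eq_zero_right this.symm).symm
  calc mder δ B = (B * A) * mder δ B := by rw [h', one_mul]
    _ = _ := by rw [mul_assoc, h2, mul_neg, mul_assoc]

/-- The ring homomorphism `a ↦ a + ε δ a` to the dual numbers. -/
def toDual (δ : Derivation ℝ S S) : S →+* DualNumber S where
  toFun a := TrivSqZeroExt.inl a + TrivSqZeroExt.inr (δ a)
  map_one' := by ext <;> simp
  map_zero' := by ext <;> simp
  map_add' a b := by ext <;> simp
  map_mul' a b := by ext <;> simp [mul_comm]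

/-- Jacobi's formula for the derivative of a determinant. -/
lemma derivation_det (δ : Derivation ℝ S S) {A H : Matrix ι ι S}
    (hH : mder δ A = A * H) : δ A.det = A.det * H.trace := by
  -- Over the dual numbers $A + \varepsilon\,\delta A = A(1+\varepsilon H)$, and $\det(1+\varepsilon
  -- H) = 1+\varepsilon\,\mathrm{tr}\,H$ because $\varepsilon^2 = 0$. The $\varepsilon$-part of the
  -- determinant is the claim.
  have h1 : (toDual δ).mapMatrix A =
      (TrivSqZeroExt.inlHom S S).mapMatrix A *
        (1 + (DualNumber.eps : DualNumber S) • (TrivSqZeroExt.inlHom S S).mapMatrix H) := by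
    rw [mul_add, mul_one, mul_smul_comm, ← map_mul, ← hH]
    ext a b <;> simp [toDual]
  have h2 := congrArg Matrix.det h1
  have ht : ((TrivSqZeroExt.inlHom S S).mapMatrix H).trace = TrivSqZeroExt.inl H.trace :=
    (map_sum (TrivSqZeroExt.inlHom S S) (fun i => H i i) Finset.univ).symm
  rw [Matrix.det_mul, ← RingHom.map_det, ← RingHom.map_det, Matrix.det_one_add_smul, sq,
    DualNumber.eps_mul_eps, mul_zero, add_zero, ht] at h2
  have h3 := congrArg TrivSqZeroExt.snd h2
  simpa [toDual] using h3

end MatrixDerivation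

/-! ### Variations of a metric over a ring with commuting derivations -/

/-- A metric `G` with Levi-Civita connection `Γ`, over a ring with commuting coordinate
derivations `par` and a time derivation `dt`, with `H = G⁻¹ dG/dt` and a function `f` that varies
like `log (dV_g / Ω)`. -/
structure Variation (S : Type*) [CommRing S] [Algebra ℝ S] (ι : Type*) [Fintype ι]
    [DecidableEq ι] where
  par : ι → Derivation ℝ S S
  dt : Derivation ℝ S S
  par_comm : ∀ i j a, par i (par j a) = par j (par i a)
  dt_comm : ∀ i a, dt (par i a) = par i (dt a)
  G : Matrix ι ι S
  Gi : Matrix ι ι S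
  G_symm : G.transpose = G
  G_mul_Gi : G * Gi = 1
  Γ : ι → Matrix ι ι S
  torsion : ∀ i j k, Γ i k j = Γ j k i
  compat : ∀ i, mder (par i) G = (Γ i).transpose * G + G * Γ i
  H : Matrix ι ι S
  dt_G : mder dt G = G * H
  f : S
  dt_f : dt f + dt f = H.trace

namespace Variation

variable {S : Type*} [CommRing S] [Algebra ℝ S] {ι : Type*} [Fintype ι] [DecidableEq ι]
variable (D : Variation S ι)

/-- The covariant derivative of an endomorphism field. -/
def cov (i : ι) (X : Matrix ι ι S) : Matrix ι ι S := mder (D.par i) X + (D.Γ i * X - X * D.Γ i)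

/-- The curvature endomorphisms. -/
def curv (i j : ι) : Matrix ι ι S :=
  mder (D.par i) (D.Γ j) - mder (D.par j) (D.Γ i) + (D.Γ i * D.Γ j - D.Γ j * D.Γ i)

/-- The Ricci tensor. -/
def ric : Matrix ι ι S := Matrix.of fun j k => ∑ i, D.curv i j i k

/-- The Hessian of `f`. -/
def hess : Matrix ι ι S :=
  Matrix.of fun i j => D.par i (D.par j D.f) - ∑ k, D.Γ i k j * D.par k D.f

/-- The second covariant derivative of `H`. -/
def covTwo (i j : ι) : Matrix ι ι S := D.cov i (D.cov j D.H) - ∑ m, D.Γ i m j • D.cov m D.H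

/-- The third covariant derivative of `H`. -/
def covThree (i k l : ι) : Matrix ι ι S :=
  D.cov i (D.covTwo k l) - ∑ m, D.Γ i m k • D.covTwo m l - ∑ m, D.Γ i m l • D.covTwo k m

/-- The gradient of `f`. -/
def grad (k : ι) : S := ∑ l, D.Gi k l * D.par l D.f

/-! ### Formal Levi-Civita calculus and curvature symmetries -/

lemma Gi_mul_G : D.Gi * D.G = 1 := mul_eq_one_comm.mp D.G_mul_Gi

lemma Gi_symm : D.Gi.transpose = D.Gi := by
  have h := congrArg Matrix.transpose D.G_mul_Gi
  rw [Matrix.transpose_mul, D.G_symm, Matrix.transpose_one] at h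
  calc D.Gi.transpose = D.Gi.transpose * (D.G * D.Gi) := by rw [D.G_mul_Gi, mul_one]
    _ = D.Gi := by rw [← mul_assoc, h, one_mul]

/-- Two is invertible in an `ℝ`-algebra. Identities carrying a factor $1/2$ are therefore stated in
the doubled form `x + x` and halved here. -/
lemma eq_of_two {a b : S} (h : a + a = b + b) : a = b := by
  have := congrArg (fun x => (1 / 2 : ℝ) • x) h
  simpa [← two_smul ℝ, smul_smul] using this

lemma H_selfAdjoint : D.H.transpose * D.G = D.G * D.H := by
  have h := mder_transpose D.dt D.G
  rw [D.G_symm, D.dt_G, Matrix.transpose_mul, D.G_symm] at h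
  exact h.symm

lemma mder_dt_Gi : mder D.dt D.Gi = -(D.H * D.Gi) := by
  rw [mder_inv D.dt D.G_mul_Gi, D.dt_G, ← mul_assoc, D.Gi_mul_G, one_mul]

lemma mder_par_Gi (i : ι) :
    mder (D.par i) D.Gi = -(D.Γ i * D.Gi) - D.Gi * (D.Γ i).transpose := by
  rw [mder_inv _ D.G_mul_Gi, D.compat, mul_add, add_mul, ← mul_assoc D.Gi D.G, D.Gi_mul_G,
    one_mul, mul_assoc D.Gi, mul_assoc _ D.G, D.G_mul_Gi, mul_one]
  abel

lemma cov_add (i : ι) (X Y : Matrix ι ι S) : D.cov i (X + Y) = D.cov i X + D.cov i Y := by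
  simp only [cov, mder_add]; noncomm_ring

lemma cov_sub (i : ι) (X Y : Matrix ι ι S) : D.cov i (X - Y) = D.cov i X - D.cov i Y := by
  simp only [cov, mder_sub]; noncomm_ring

lemma cov_mul (i : ι) (X Y : Matrix ι ι S) :
    D.cov i (X * Y) = D.cov i X * Y + X * D.cov i Y := by
  simp only [cov, mder_mul]; noncomm_ring

lemma cov_smul (i : ι) (s : S) (X : Matrix ι ι S) :
    D.cov i (s • X) = s • D.cov i X + D.par i s • X := by
  simp only [cov, mder_smul, mul_smul_comm, smul_mul_assoc, smul_add, smul_sub]; abel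

lemma cov_sum {κ : Type*} (i : ι) (s : Finset κ) (X : κ → Matrix ι ι S) :
    D.cov i (∑ k ∈ s, X k) = ∑ k ∈ s, D.cov i (X k) := by
  simp only [cov, mder_sum, Finset.mul_sum, Finset.sum_mul, Finset.sum_add_distrib,
    Finset.sum_sub_distrib]

lemma trace_cov (i : ι) (X : Matrix ι ι S) : (D.cov i X).trace = D.par i X.trace := by
  rw [cov, Matrix.trace_add, Matrix.trace_sub, Matrix.trace_mul_comm, sub_self, add_zero]
  simp [Matrix.trace]

/-- The Ricci identity for endomorphism fields. -/
lemma cov_cov_sub (i j : ι) (X : Matrix ι ι S) :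
    D.cov i (D.cov j X) - D.cov j (D.cov i X) = D.curv i j * X - X * D.curv i j := by
  simp only [cov, curv, mder_add, mder_sub, mder_mul, mder_comm (D.par_comm i j)]
  noncomm_ring

lemma cov_selfAdjoint (i : ι) {X : Matrix ι ι S} (h : X.transpose * D.G = D.G * X) :
    (D.cov i X).transpose * D.G = D.G * D.cov i X := by
  have h1 := congrArg (mder (D.par i)) h
  simp only [mder_mul, D.compat, mder_transpose] at h1
  simp only [cov, Matrix.transpose_add, Matrix.transpose_sub, Matrix.transpose_mul]
  have h2 : X.transpose * (D.Γ i).transpose * D.G + D.G * X * D.Γ i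
     = X.transpose * (D.Γ i).transpose * D.G + X.transpose * D.G * D.Γ i := by rw [h]
  have h3 : (D.Γ i).transpose * D.G * X = (D.Γ i).transpose * X.transpose * D.G := by
    rw [mul_assoc, mul_assoc, h]
  linear_combination (norm := noncomm_ring) h1 + h3 + h2

lemma mder_dt_cov (i : ι) (X : Matrix ι ι S) :
    mder D.dt (D.cov i X) =
      D.cov i (mder D.dt X) + (mder D.dt (D.Γ i) * X - X * mder D.dt (D.Γ i)) := by
  simp only [cov, mder_add, mder_sub, mder_mul, mder_comm (D.dt_comm i)]
  noncomm_ring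

/-- Palatini's identity. `cov` treats $\dot\Gamma_j$ as an endomorphism with $j$ fixed; the
corrections $\Gamma^m_{ij}\dot\Gamma_m$ are symmetric in $i,j$ and would cancel. -/
lemma mder_dt_curv (i j : ι) :
    mder D.dt (D.curv i j) = D.cov i (mder D.dt (D.Γ j)) - D.cov j (mder D.dt (D.Γ i)) := by
  simp only [cov, curv, mder_add, mder_sub, mder_mul, mder_comm (D.dt_comm i),
    mder_comm (D.dt_comm j)]
  noncomm_ring

/-- The curvature endomorphisms are skew-adjoint. -/
lemma curv_skew (i j : ι) : (D.curv i j).transpose * D.G + D.G * D.curv i j = 0 := by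
  have h := mder_comm (D.par_comm i j) D.G
  simp only [D.compat, mder_add, mder_mul, mder_transpose] at h
  simp only [curv, Matrix.transpose_add, Matrix.transpose_sub, Matrix.transpose_mul]
  rw [← sub_eq_zero] at h
  rw [← h]
  noncomm_ring

lemma curv_swap (i j : ι) : D.curv j i = -D.curv i j := by
  simp only [curv]; abel

/-- The first Bianchi identity. -/
lemma bianchi (i j k m : ι) : D.curv i j m k + D.curv j k m i + D.curv k i m j = 0 := by
  simp only [curv, Matrix.add_apply, Matrix.sub_apply, mder_apply, Matrix.mul_apply]
  simp only [D.torsion j k, D.torsion i k, D.torsion i j]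
  ring

/-- A skew-adjoint endomorphism is conjugate to minus its transpose. -/
lemma trace_curv (i j : ι) : (D.curv i j).trace = 0 := by
  have h := D.curv_skew i j
  have h1 : D.curv i j = -(D.Gi * (D.curv i j).transpose * D.G) := by
    rw [eq_neg_iff_add_eq_zero]
    calc _ = D.Gi * (D.G * D.curv i j) + D.Gi * ((D.curv i j).transpose * D.G) := by
          rw [← mul_assoc, D.Gi_mul_G, one_mul, mul_assoc]
      _ = 0 := by rw [← mul_add, add_comm, h, mul_zero]
  have h2 := congrArg Matrix.trace h1
  rw [Matrix.trace_neg, Matrix.trace_mul_cycle, D.G_mul_Gi, one_mul, Matrix.trace_transpose] at h2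
  refine eq_of_two ?_
  rw [add_zero]
  exact eq_neg_iff_add_eq_zero.mp h2

lemma ric_symm (j k : ι) : D.ric j k = D.ric k j := by
  have h : ∑ i, D.curv i j i k - ∑ i, D.curv i k i j = -(D.curv j k).trace := by
    rw [← Finset.sum_sub_distrib, Matrix.trace, ← Finset.sum_neg_distrib]
    refine Finset.sum_congr rfl fun i _ => ?_
    have := D.bianchi i j k i
    rw [D.curv_swap i k] at this
    simp only [Matrix.neg_apply, Matrix.diag_apply] at this ⊢
    linear_combination this
  rw [D.trace_curv, neg_zero, sub_eq_zero] at h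
  exact h

lemma curv_mul_Gi (i j : ι) : D.curv i j * D.Gi = -(D.Gi * (D.curv i j).transpose) := by
  rw [eq_neg_iff_add_eq_zero]
  calc _ = D.Gi * ((D.curv i j).transpose * D.G + D.G * D.curv i j) * D.Gi := by
        rw [mul_add, add_mul, mul_assoc D.Gi (_ * _), mul_assoc _ D.G, D.G_mul_Gi, mul_one,
          ← mul_assoc D.Gi D.G, D.Gi_mul_G, one_mul, add_comm]
    _ = 0 := by rw [D.curv_skew, mul_zero, zero_mul]

/-- The contraction of the curvature is the Ricci endomorphism. -/
lemma sum_curv (i m : ι) :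
    ∑ k, ∑ l, D.Gi k l * D.curv i k m l = (D.Gi * D.ric) m i := by
  -- Skew-adjointness exchanges the free index $m$ with the summed $k$, so that summing over $k$
  -- becomes the contraction defining `ric`.
  have h (k : ι) : ∑ l, D.Gi k l * D.curv i k m l = ∑ l, D.Gi m l * D.curv k i k l := by
    have h1 := congrFun (congrFun (D.curv_mul_Gi i k) m) k
    simp only [Matrix.neg_apply, Matrix.mul_apply, Matrix.transpose_apply] at h1
    calc _ = ∑ l, D.curv i k m l * D.Gi l k := Finset.sum_congr rfl fun l _ => by
          rw [← D.Gi_symm, Matrix.transpose_apply, D.Gi_symm, mul_comm]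
      _ = _ := by
        rw [h1, ← Finset.sum_neg_distrib]
        refine Finset.sum_congr rfl fun l _ => ?_
        rw [D.curv_swap i k, Matrix.neg_apply, mul_neg]
  simp_rw [h]
  rw [Finset.sum_comm, Matrix.mul_apply]
  refine Finset.sum_congr rfl fun l _ => ?_
  rw [D.ric_symm, ← Finset.mul_sum]
  rfl

/-- The condition defining `𝔽`. -/
def InF : Prop := ∀ i j k, D.cov i D.H k j = D.cov j D.H k i

/-- The first condition defining `𝔼`. -/
def InE : Prop := ∀ i j, D.curv i j * D.H = D.H * D.curv i j

/-- The second condition defining `𝔼`. -/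
def InE' : Prop := ∀ i j k, D.curv i j * D.cov k D.H = D.cov k D.H * D.curv i j

/-! ### First variation of connection and curvature; symmetries of the derivatives of $H$ -/

variable {D}

/-- The variation of the Levi-Civita connection. -/
lemma two_mder_dt_Γ (hF : D.InF) (i : ι) :
    mder D.dt (D.Γ i) + mder D.dt (D.Γ i) = D.cov i D.H := by
  set C : ι → Matrix ι ι S := fun k => D.G * mder D.dt (D.Γ k) with hC
  set N : ι → Matrix ι ι S := fun k => D.G * D.cov k D.H with hN
  have hCN (k : ι) : (C k).transpose + C k = N k := by
    have h := mder_comm (D.dt_comm k) D.G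
    simp only [D.compat, D.dt_G, mder_add, mder_mul, mder_transpose] at h
    simp only [hC, hN, Matrix.transpose_mul, D.G_symm, cov]
    linear_combination (norm := noncomm_ring) h
  have hNs (k a b : ι) : N k a b = N k b a := by
    have h := D.cov_selfAdjoint k D.H_selfAdjoint
    have h1 : (N k).transpose = N k := by
      rw [hN]; simp only [Matrix.transpose_mul, D.G_symm, h]
    exact (congrFun (congrFun h1 b) a)
  have hNF (k a b : ι) : N k a b = N b a k := by
    simp only [hN, Matrix.mul_apply]
    exact Finset.sum_congr rfl fun m _ => by rw [hF]
  have hCs (k a b : ι) : C k a b = C b a k := by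
    simp only [hC, Matrix.mul_apply, mder_apply]
    exact Finset.sum_congr rfl fun m _ => by rw [D.torsion]
  -- As in Koszul's formula: $C_k = G\dot\Gamma_k$ is symmetric in $k$ and its column, $N_k =
  -- G\nabla_kH$ is totally symmetric, and the alternating sum of three permutations of $C_k^T + C_k
  -- = N_k$ isolates $2C_k$.
  have key (k a b : ι) : C k a b + C k a b = N k a b := by
    have e1 := congrFun (congrFun (hCN k) a) b
    have e2 := congrFun (congrFun (hCN a) b) k
    have e3 := congrFun (congrFun (hCN b) a) k
    simp only [Matrix.add_apply, Matrix.transpose_apply] at e1 e2 e3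
    rw [hCs a k b, hCs a b k, hNF a b k, hNs k b a] at e2
    rw [hCs b k a, hCs b a k, hNF b a k, hCs a k b] at e3
    rw [hCs k b a] at e1 e2
    linear_combination e1 + e3 - e2
  have h1 : D.G * (mder D.dt (D.Γ i) + mder D.dt (D.Γ i)) = D.G * D.cov i D.H := by
    rw [mul_add]; ext a b; exact key i a b
  have h2 := congrArg (D.Gi * ·) h1
  simpa only [← mul_assoc, D.Gi_mul_G, one_mul] using h2

/-- The curvature does not vary. -/
lemma mder_dt_curv_eq_zero (hF : D.InF) (hE : D.InE) (i j : ι) : mder D.dt (D.curv i j) = 0 := by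
  have h : mder D.dt (D.curv i j) + mder D.dt (D.curv i j) = 0 := by
    have h1 := D.cov_cov_sub i j D.H
    rw [hE, sub_self, ← two_mder_dt_Γ hF i, ← two_mder_dt_Γ hF j, cov_add, cov_add] at h1
    rw [mder_dt_curv, ← h1]; abel
  ext a b
  have := congrFun (congrFun h a) b
  exact eq_of_two (by simpa using this)

lemma mder_dt_ric (hF : D.InF) (hE : D.InE) : mder D.dt D.ric = 0 := by
  ext j k
  simp only [ric, mder_apply, Matrix.of_apply, map_sum, Matrix.zero_apply]
  refine Finset.sum_eq_zero fun i _ => ?_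
  exact congrFun (congrFun (mder_dt_curv_eq_zero hF hE i j) i) k

lemma covTwo_comm (hE : D.InE) (i j : ι) : D.covTwo i j = D.covTwo j i := by
  have h := D.cov_cov_sub i j D.H
  rw [hE, sub_self, sub_eq_zero] at h
  simp only [covTwo, h, D.torsion i j]

/-- Differentiating a family of matrices that is symmetric in the index and the column. -/
lemma cov_col {Y : ι → Matrix ι ι S} (hY : ∀ j k a, Y j a k = Y k a j) (i j k a : ι) :
    (D.cov i (Y j) - ∑ m, D.Γ i m j • Y m) a k = (D.cov i (Y k) - ∑ m, D.Γ i m k • Y m) a j := by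
  simp only [cov, Matrix.sub_apply, Matrix.add_apply, Matrix.sum_apply, Matrix.smul_apply,
    mder_apply, Matrix.mul_apply, smul_eq_mul]
  rw [hY j k a]
  have h1 (j k : ι) : ∑ m, Y j a m * D.Γ i m k = ∑ m, D.Γ i m k * Y m a j :=
    Finset.sum_congr rfl fun m _ => by rw [hY j m, mul_comm]
  have h2 : ∑ m, D.Γ i a m * Y j m k = ∑ m, D.Γ i a m * Y k m j :=
    Finset.sum_congr rfl fun m _ => by rw [hY j k]
  rw [h1, h1, h2]; ring

lemma covTwo_col (hF : D.InF) (i j k a : ι) : D.covTwo i j a k = D.covTwo i k a j :=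
  cov_col (fun j k a => hF j k a) i j k a

lemma covThree_col (hF : D.InF) (i k l j a : ι) :
    D.covThree i k l a j = D.covThree i k j a l := by
  have h := cov_col (D := D) (fun l j a => covTwo_col hF k l j a) i l j a
  have h2 (l j : ι) : ∑ m, D.Γ i m k * D.covTwo m l a j = ∑ m, D.Γ i m k * D.covTwo m j a l :=
    Finset.sum_congr rfl fun m _ => by rw [covTwo_col hF]
  simp only [covThree, Matrix.sub_apply, Matrix.sum_apply, Matrix.smul_apply, smul_eq_mul] at h ⊢
  rw [h2]
  linear_combination h

/-- The Ricci identity for the covariant derivative of `H`. -/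
lemma covThree_sub (hE' : D.InE') (i k l : ι) :
    D.covThree i k l = D.covThree k i l - ∑ m, D.curv i k m l • D.cov m D.H := by
  have h := D.cov_cov_sub i k (D.cov l D.H)
  rw [hE', sub_self, sub_eq_zero] at h
  -- The expansion is arranged so that everything is symmetric in $i,k$ except the
  -- $\partial_i\Gamma_k$ and $\Gamma_k\Gamma_i$ terms, whose antisymmetrization is minus the
  -- curvature.
  have e (i k : ι) : D.covThree i k l = D.cov i (D.cov k (D.cov l D.H))
      - (∑ m, D.Γ k m l • D.cov i (D.cov m D.H) + ∑ m, D.Γ i m l • D.cov k (D.cov m D.H))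
      - ∑ m, D.par i (D.Γ k m l) • D.cov m D.H
      - ∑ m, D.Γ i m k • D.covTwo m l + ∑ m, (D.Γ k * D.Γ i) m l • D.cov m D.H := by
    have e1 : ∑ m, (D.Γ k * D.Γ i) m l • D.cov m D.H
        = ∑ m, D.Γ i m l • ∑ p, D.Γ k p m • D.cov p D.H := by
      simp only [Matrix.mul_apply, Finset.sum_smul, Finset.smul_sum, smul_smul]
      rw [Finset.sum_comm]
      exact Finset.sum_congr rfl fun m _ => Finset.sum_congr rfl fun p _ => by rw [mul_comm]
    rw [e1]
    simp only [covThree, covTwo, cov_sub, cov_sum, cov_smul, smul_sub, Finset.sum_add_distrib,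
      Finset.sum_sub_distrib]
    abel
  rw [e i k, e k i, h]
  simp only [D.torsion i k, curv, Matrix.add_apply, Matrix.sub_apply, mder_apply, add_smul,
    sub_smul, Finset.sum_add_distrib, Finset.sum_sub_distrib]
  abel

lemma covTwo_selfAdjoint (i j : ι) :
    (D.covTwo i j).transpose * D.G = D.G * D.covTwo i j := by
  have h (m : ι) := D.cov_selfAdjoint m D.H_selfAdjoint
  simp only [covTwo, Matrix.transpose_sub, Matrix.transpose_sum, Matrix.transpose_smul, sub_mul,
    mul_sub, Finset.sum_mul, Finset.mul_sum, smul_mul_assoc, mul_smul_comm, h,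
    D.cov_selfAdjoint i (h j)]

lemma G_mul_apply_comm {X : Matrix ι ι S} (h : X.transpose * D.G = D.G * X) (a b : ι) :
    (D.G * X) a b = (D.G * X) b a := by
  have h1 : (D.G * X).transpose = D.G * X := by rw [Matrix.transpose_mul, D.G_symm, h]
  exact congrFun (congrFun h1 b) a

/-- The lowered second derivative of $H$ is totally symmetric: the derivative indices commute by
$\mathbb E$, the last one swaps with the column by $\mathbb F$, and self-adjointness swaps row and
column. These transpositions generate the required pair exchange. -/
lemma G_mul_covTwo (hF : D.InF) (hE : D.InE) (i j k l : ι) :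
    (D.G * D.covTwo k l) i j = (D.G * D.covTwo i j) l k := by
  have c (i j k a : ι) : (D.G * D.covTwo i j) a k = (D.G * D.covTwo i k) a j := by
    simp only [Matrix.mul_apply]
    exact Finset.sum_congr rfl fun m _ => by rw [covTwo_col hF]
  rw [c k l j, covTwo_comm hE k j, c j k l, G_mul_apply_comm (covTwo_selfAdjoint _ _), c j l i,
    covTwo_comm hE j i, G_mul_apply_comm (covTwo_selfAdjoint _ _)]

variable (D) in
/-- The rough Laplacian of `H`. -/
def lap : Matrix ι ι S := ∑ k, ∑ l, D.Gi k l • D.covTwo k l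

variable (D) in
/-- The derivative of `H` along the gradient of `f`. -/
def drift : Matrix ι ι S := ∑ k, D.grad k • D.cov k D.H

/-- Total symmetry turns the metric contraction over the derivative indices into a trace of the
endomorphism. This matches the Laplacian with the Hessian of $\mathrm{tr}\,H = 2\dot f$. -/
lemma G_mul_lap (hF : D.InF) (hE : D.InE) (i j : ι) :
    (D.G * D.lap) i j = (D.covTwo i j).trace := by
  have h : (D.G * D.lap) i j = (D.Gi * (D.G * D.covTwo i j)).trace := by
    simp only [lap, Finset.mul_sum, mul_smul_comm, Matrix.sum_apply, Matrix.smul_apply,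
      G_mul_covTwo hF hE i j, smul_eq_mul]
    rfl
  rw [h, ← mul_assoc, D.Gi_mul_G, one_mul]

lemma sum_G_grad (l : ι) : ∑ k, D.G l k * D.grad k = D.par l D.f := by
  have h := D.G_mul_Gi
  have : D.G.mulVec (D.Gi.mulVec fun l => D.par l D.f) = fun l => D.par l D.f := by
    rw [Matrix.mulVec_mulVec, h, Matrix.one_mulVec]
  exact congrFun this l

lemma G_mul_drift (hF : D.InF) (i j : ι) :
    (D.G * D.drift) i j = ∑ k, D.par k D.f * D.cov i D.H k j := by
  have h (k : ι) : (D.G * D.cov k D.H) i j = ∑ l, D.G k l * D.cov i D.H l j := by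
    rw [G_mul_apply_comm (D.cov_selfAdjoint k D.H_selfAdjoint)]
    have : (D.G * D.cov k D.H) j i = (D.G * D.cov i D.H) j k := by
      simp only [Matrix.mul_apply]
      exact Finset.sum_congr rfl fun m _ => by rw [hF]
    rw [this, G_mul_apply_comm (D.cov_selfAdjoint i D.H_selfAdjoint)]
    rfl
  simp only [drift, Finset.mul_sum, mul_smul_comm, Matrix.sum_apply, Matrix.smul_apply, h,
    smul_eq_mul]
  rw [Finset.sum_comm]
  refine Finset.sum_congr rfl fun l _ => ?_
  rw [← sum_G_grad, Finset.sum_mul]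
  refine Finset.sum_congr rfl fun k _ => ?_
  rw [← D.G_symm, Matrix.transpose_apply, D.G_symm]; ring

/-- The variation of the Hessian of `f`. -/
lemma two_mder_dt_hess (hF : D.InF) (hE : D.InE) :
    mder D.dt D.hess + mder D.dt D.hess = D.G * (D.lap - D.drift) := by
  ext i j
  rw [mul_sub, Matrix.sub_apply, G_mul_lap hF hE, G_mul_drift hF]
  have hΓ (k : ι) : D.dt (D.Γ i k j) + D.dt (D.Γ i k j) = D.cov i D.H k j :=
    congrFun (congrFun (two_mder_dt_Γ hF i) k) j
  have hf (k : ι) : D.par k (D.dt D.f) + D.par k (D.dt D.f) = (D.cov k D.H).trace := by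
    rw [trace_cov, ← D.dt_f, map_add]
  have h1 : (D.covTwo i j).trace = D.par i (D.par j (D.dt D.f)) + D.par i (D.par j (D.dt D.f))
      - ∑ k, D.Γ i k j * (D.par k (D.dt D.f) + D.par k (D.dt D.f)) := by
    rw [covTwo, Matrix.trace_sub, trace_cov, ← hf, map_add, Matrix.trace_sum]
    simp only [Matrix.trace_smul, ← hf, smul_eq_mul]
  rw [h1]
  simp only [hess, Matrix.add_apply, mder_apply, Matrix.of_apply, map_sub, map_sum,
    Derivation.leibniz, smul_eq_mul, D.dt_comm, ← hΓ, Finset.sum_add_distrib, mul_add]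
  ring

variable (D) in
/-- The Bakry-Emery-Ricci endomorphism. -/
def ber : Matrix ι ι S := D.Gi * (D.ric + D.hess)

variable (D) in
/-- The covariant exterior derivative of an endomorphism field. -/
def ext (X : Matrix ι ι S) (i j k : ι) : S := D.cov i X k j - D.cov j X k i

lemma two_mder_dt_ber (hF : D.InF) (hE : D.InE) :
    mder D.dt D.ber + mder D.dt D.ber = D.lap - D.drift - D.H * D.ber - D.H * D.ber := by
  have h := two_mder_dt_hess hF hE
  have h1 : D.lap - D.drift = D.Gi * (mder D.dt D.hess + mder D.dt D.hess) := by
    rw [h, ← mul_assoc, D.Gi_mul_G, one_mul]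
  rw [h1, ber, mder_mul, mder_add, mder_dt_ric hF hE, mder_dt_Gi]
  noncomm_ring

lemma hess_symm (i j : ι) : D.hess i j = D.hess j i := by
  simp only [hess, Matrix.of_apply, D.par_comm i j, D.torsion i j]

/-- The covariant derivative of the gradient is the Hessian endomorphism. -/
lemma par_grad (i k : ι) :
    D.par i (D.grad k) + ∑ m, D.Γ i k m * D.grad m = (D.Gi * D.hess) k i := by
  have hGi (l : ι) : D.par i (D.Gi k l) =
      -(∑ m, D.Γ i k m * D.Gi m l) - ∑ m, D.Gi k m * D.Γ i l m :=
    congrFun (congrFun (D.mder_par_Gi i) k) l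
  have h1 : ∑ m, D.Γ i k m * D.grad m
      = ∑ l, (∑ m, D.Γ i k m * D.Gi m l) * D.par l D.f := by
    simp only [grad, Finset.mul_sum, Finset.sum_mul, mul_assoc]
    exact Finset.sum_comm
  have h2 : ∑ l, D.Gi k l * ∑ m, D.Γ i m l * D.par m D.f
      = ∑ l, (∑ m, D.Gi k m * D.Γ i l m) * D.par l D.f := by
    simp only [Finset.mul_sum, Finset.sum_mul, mul_assoc]
    exact Finset.sum_comm
  simp only [Matrix.mul_apply, hess_symm _ i]
  rw [h1]
  simp only [hess, Matrix.of_apply, mul_sub, Finset.sum_sub_distrib]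
  rw [h2]
  simp only [grad, map_sum, Derivation.leibniz, smul_eq_mul, hGi, ← Finset.sum_add_distrib,
    ← Finset.sum_sub_distrib]
  exact Finset.sum_congr rfl fun l _ => by ring

lemma cov_drift (i : ι) :
    D.cov i D.drift = ∑ k, (D.Gi * D.hess) k i • D.cov k D.H
      + ∑ k, D.grad k • D.covTwo i k := by
  have h : ∑ k, D.grad k • ∑ m, D.Γ i m k • D.cov m D.H
      = ∑ k, (∑ m, D.Γ i k m * D.grad m) • D.cov k D.H := by
    simp only [Finset.smul_sum, Finset.sum_smul, smul_smul]
    rw [Finset.sum_comm]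
    exact Finset.sum_congr rfl fun m _ => Finset.sum_congr rfl fun p _ => by rw [mul_comm]
  simp only [drift, cov_sum, cov_smul, covTwo, smul_sub, Finset.sum_sub_distrib, ← par_grad,
    add_smul, Finset.sum_add_distrib, h]
  abel

/-- On `𝔽`, contracting `cov k H` in the index `k` amounts to applying it to a vector. -/
lemma sum_smul_cov_apply (hF : D.InF) (s : ι → S) (j a : ι) :
    (∑ k, s k • D.cov k D.H) a j = ∑ k, D.cov j D.H a k * s k := by
  simp only [Matrix.sum_apply, Matrix.smul_apply, smul_eq_mul]
  exact Finset.sum_congr rfl fun k _ => by rw [hF, mul_comm]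

/-- In $\nabla_i(\nabla_{\mathrm{grad} f}H)$ the second derivatives of $H$ are symmetric in $i$ and
the column and cancel; what survives is $\nabla H$ along $\nabla_i\,\mathrm{grad} f$, the Hessian.
-/
lemma ext_drift (hF : D.InF) (hE : D.InE) (i j a : ι) :
    D.ext D.drift i j a = (D.cov j D.H * (D.Gi * D.hess)) a i
      - (D.cov i D.H * (D.Gi * D.hess)) a j := by
  have h : (∑ k, D.grad k • D.covTwo i k) a j = (∑ k, D.grad k • D.covTwo j k) a i := by
    simp only [Matrix.sum_apply, Matrix.smul_apply]
    exact Finset.sum_congr rfl fun k _ => by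
      rw [covTwo_comm hE i k, covTwo_col hF, covTwo_comm hE k j]
  rw [ext, cov_drift, cov_drift, Matrix.add_apply, Matrix.add_apply, h, sum_smul_cov_apply hF,
    sum_smul_cov_apply hF, Matrix.mul_apply, Matrix.mul_apply]
  ring

/-- The inverse metric is parallel, so $\nabla_i$ passes through the contraction. -/
lemma cov_lap (i : ι) : D.cov i D.lap = ∑ k, ∑ l, D.Gi k l • D.covThree i k l := by
  have hGi (k l : ι) : D.par i (D.Gi k l) =
      -(∑ m, D.Γ i k m * D.Gi m l) - ∑ m, D.Gi k m * D.Γ i l m :=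
    congrFun (congrFun (D.mder_par_Gi i) k) l
  have h1 : ∑ k, ∑ l, D.Gi k l • ∑ m, D.Γ i m k • D.covTwo m l
      = ∑ k, ∑ l, (∑ m, D.Γ i k m * D.Gi m l) • D.covTwo k l := by
    simp only [Finset.smul_sum, Finset.sum_smul, smul_smul]
    rw [Finset.sum_comm]
    conv_rhs => rw [Finset.sum_comm]
    refine Finset.sum_congr rfl fun l _ => ?_
    rw [Finset.sum_comm]
    exact Finset.sum_congr rfl fun m _ => Finset.sum_congr rfl fun p _ => by rw [mul_comm]
  have h2 : ∑ k, ∑ l, D.Gi k l • ∑ m, D.Γ i m l • D.covTwo k m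
      = ∑ k, ∑ l, (∑ m, D.Gi k m * D.Γ i l m) • D.covTwo k l := by
    simp only [Finset.smul_sum, Finset.sum_smul, smul_smul]
    exact Finset.sum_congr rfl fun k _ => Finset.sum_comm
  simp only [lap, cov_sum, cov_smul, covThree, smul_sub, Finset.sum_sub_distrib, hGi, sub_smul,
    neg_smul, Finset.sum_add_distrib, Finset.sum_neg_distrib, h1, h2]
  abel

lemma covThree_comm (hE : D.InE) (k i j : ι) : D.covThree k i j = D.covThree k j i := by
  have h (i j : ι) : ∑ m, D.Γ k m i • D.covTwo m j = ∑ m, D.Γ k m i • D.covTwo j m :=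
    Finset.sum_congr rfl fun m _ => by rw [covTwo_comm hE]
  rw [covThree, covThree, covTwo_comm hE i j, h i j, h j i, sub_right_comm]

lemma ext_lap (hF : D.InF) (hE : D.InE) (hE' : D.InE') (i j a : ι) :
    D.ext D.lap i j a = (D.cov i D.H * (D.Gi * D.ric)) a j
      - (D.cov j D.H * (D.Gi * D.ric)) a i := by
  have h (i : ι) : D.cov i D.lap = ∑ k, ∑ l, D.Gi k l • D.covThree k i l
      - ∑ m, (D.Gi * D.ric) m i • D.cov m D.H := by
    rw [cov_lap]
    simp only [covThree_sub hE' i, smul_sub, Finset.sum_sub_distrib, ← sum_curv, Finset.sum_smul,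
      Finset.smul_sum, smul_smul]
    congr 1
    conv_rhs => rw [Finset.sum_comm]
    refine Finset.sum_congr rfl fun k _ => ?_
    rw [Finset.sum_comm]
  -- Once $\nabla_i$ has moved past $\nabla_k$, the indices $i,l,j$ are interchangeable, so the
  -- third-order part drops out of the antisymmetrization.
  have h2 : (∑ k, ∑ l, D.Gi k l • D.covThree k i l) a j
      = (∑ k, ∑ l, D.Gi k l • D.covThree k j l) a i := by
    simp only [Matrix.sum_apply, Matrix.smul_apply]
    refine Finset.sum_congr rfl fun k _ => Finset.sum_congr rfl fun l _ => ?_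
    rw [covThree_col hF, covThree_comm hE, covThree_col hF]
  rw [ext, h, h, Matrix.sub_apply, Matrix.sub_apply, h2, sum_smul_cov_apply hF,
    sum_smul_cov_apply hF, Matrix.mul_apply, Matrix.mul_apply]
  ring

lemma ext_sub (X Y : Matrix ι ι S) (i j a : ι) :
    D.ext (X - Y) i j a = D.ext X i j a - D.ext Y i j a := by
  simp only [ext, cov_sub, Matrix.sub_apply]; ring

lemma ext_H_mul (X : Matrix ι ι S) (i j a : ι) :
    D.ext (D.H * X) i j a = (D.cov i D.H * X) a j - (D.cov j D.H * X) a i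
      + ∑ m, D.H a m * D.ext X i j m := by
  simp only [ext, cov_mul, Matrix.add_apply, mul_sub, Finset.sum_sub_distrib]
  rw [Matrix.mul_apply (M := D.H), Matrix.mul_apply (M := D.H)]
  ring

/-- The variation of the covariant exterior derivative. -/
lemma two_dt_ext (hF : D.InF) (X : Matrix ι ι S) (i j a : ι) :
    D.dt (D.ext X i j a) + D.dt (D.ext X i j a)
      = D.ext (mder D.dt X + mder D.dt X) i j a
        + (D.cov i D.H * X) a j - (D.cov j D.H * X) a i := by
  have h (i j : ι) : D.dt (D.cov i X a j) + D.dt (D.cov i X a j)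
      = D.cov i (mder D.dt X + mder D.dt X) a j
        + (D.cov i D.H * X) a j - (X * D.cov i D.H) a j := by
    have h1 : mder D.dt (D.cov i X) + mder D.dt (D.cov i X)
        = D.cov i (mder D.dt X + mder D.dt X) + D.cov i D.H * X - X * D.cov i D.H := by
      rw [mder_dt_cov, ← two_mder_dt_Γ hF i, cov_add]; noncomm_ring
    exact congrFun (congrFun h1 a) j
  -- This half of the bracket $[\dot\Gamma_i, X]$ is symmetric by $\mathbb F$ and drops out.
  have h2 : (X * D.cov i D.H) a j = (X * D.cov j D.H) a i := by
    simp only [Matrix.mul_apply]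
    exact Finset.sum_congr rfl fun m _ => by rw [hF]
  have h3 := h i j
  have h4 := h j i
  simp only [ext, map_sub]
  linear_combination h3 - h4 - h2

/-- The covariant exterior derivative of the Bakry-Emery-Ricci endomorphism satisfies a linear
differential equation. -/
theorem dt_ext_ber (hF : D.InF) (hE : D.InE) (hE' : D.InE') (i j a : ι) :
    D.dt (D.ext D.ber i j a) = -∑ m, D.H a m * D.ext D.ber i j m := by
  have h := two_dt_ext hF D.ber i j a
  rw [two_mder_dt_ber hF hE, ext_sub, ext_sub, ext_sub, ext_H_mul, ext_lap hF hE hE',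
    ext_drift hF hE] at h
  have hb (i j : ι) : (D.cov i D.H * D.ber) a j = (D.cov i D.H * (D.Gi * D.ric)) a j
      + (D.cov i D.H * (D.Gi * D.hess)) a j := by
    rw [ber, mul_add, mul_add, Matrix.add_apply]
  -- The terms $\nabla_iH\,B\partial_j - \nabla_jH\,B\partial_i$ occur with total coefficient $1 - 2
  -- + 1 = 0$.
  refine eq_of_two ?_
  rw [h, hb, hb]
  ring

/-- The lowered covariant exterior derivative of the Bakry-Emery-Ricci endomorphism does not
vary. -/
theorem dt_sum_G_ext_ber (hF : D.InF) (hE : D.InE) (hE' : D.InE') (i j a : ι) :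
    D.dt (∑ b, D.G a b * D.ext D.ber i j b) = 0 := by
  have hG (b : ι) : D.dt (D.G a b) = ∑ m, D.G a m * D.H m b :=
    congrFun (congrFun D.dt_G a) b
  simp only [map_sum, Derivation.leibniz, smul_eq_mul, dt_ext_ber hF hE hE', hG,
    Finset.sum_add_distrib, mul_neg, Finset.mul_sum, Finset.sum_neg_distrib]
  rw [neg_add_eq_zero, Finset.sum_comm]
  exact Finset.sum_congr rfl fun m _ => Finset.sum_congr rfl fun b _ => by ring

end Variation

/-! ### The Levi-Civita connection over a ring with derivations -/

section LeviCivita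

variable {S : Type*} [CommRing S] [Algebra ℝ S] {ι : Type*} [Fintype ι]

/-- The Christoffel symbols of the matrix `G` with inverse `Gi`. -/
def leviCivita (par : ι → Derivation ℝ S S) (G Gi : Matrix ι ι S) (i : ι) : Matrix ι ι S :=
  Matrix.of fun k j => (1 / 2 : ℝ) • ∑ l, Gi k l *
    (par i (G j l) + par j (G i l) - par l (G i j))

variable {par : ι → Derivation ℝ S S} {G Gi : Matrix ι ι S}

lemma leviCivita_torsion (hG : G.transpose = G) (i j k : ι) :
    leviCivita par G Gi i k j = leviCivita par G Gi j k i := by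
  have h : G i j = G j i := congrFun (congrFun hG j) i
  simp only [leviCivita, Matrix.of_apply, h]
  congr 1
  exact Finset.sum_congr rfl fun l _ => by rw [add_comm (par i _)]

/-- Lowering the index of the Christoffel symbols leaves half the Koszul expression, whose last two
terms cancel on adding the transpose. -/
lemma leviCivita_compat [DecidableEq ι] (hG : G.transpose = G) (hGi : G * Gi = 1) (i : ι) :
    mder (par i) G = (leviCivita par G Gi i).transpose * G + G * leviCivita par G Gi i := by
  have hs (a b : ι) : G a b = G b a := congrFun (congrFun hG b) a
  have h (a b : ι) : (G * leviCivita par G Gi i) a b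
      = (1 / 2 : ℝ) • (par i (G b a) + par b (G i a) - par a (G i b)) := by
    simp only [Matrix.mul_apply, leviCivita, Matrix.of_apply, mul_smul_comm, ← Finset.smul_sum,
      Finset.mul_sum]
    rw [Finset.sum_comm]
    congr 1
    have (l : ι) (c : S) : ∑ k, G a k * (Gi k l * c) = (1 : Matrix ι ι S) a l * c := by
      rw [← hGi, Matrix.mul_apply, Finset.sum_mul]
      exact Finset.sum_congr rfl fun k _ => by ring
    simp only [this, Matrix.one_apply, ite_mul, one_mul, zero_mul, Finset.sum_ite_eq,
      Finset.mem_univ, if_true]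
  ext a b
  have h2 : ((leviCivita par G Gi i).transpose * G) a b = (G * leviCivita par G Gi i) b a := by
    simp only [Matrix.mul_apply, Matrix.transpose_apply]
    exact Finset.sum_congr rfl fun k _ => by rw [hs k b, mul_comm]
  rw [Matrix.add_apply, h2, h, h, ← smul_add, hs b a, hs i a, hs i b, mder_apply]
  have : par i (G a b) + par a (G b i) - par b (G a i)
      + (par i (G a b) + par b (G a i) - par a (G b i)) = (2 : ℝ) • par i (G a b) := by
    rw [two_smul]; ring
  rw [this, smul_smul]
  norm_num

end LeviCivita

/-! ### The ring of smooth functions on an open set -/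

section SmoothRing

open TopologicalSpace

variable {E : Type*} [NormedAddCommGroup E] [NormedSpace ℝ E]

/-- The algebra of smooth functions on an open set. -/
def smoothRing (O : Opens E) : Subalgebra ℝ (O → ℝ) where
  carrier := {f | ∃ F : E → ℝ, ContDiffOn ℝ ∞ F O ∧ ∀ p : O, F p = f p}
  mul_mem' := by
    rintro f g ⟨F, hF, hf⟩ ⟨K, hK, hk⟩
    exact ⟨fun p => F p * K p, hF.mul hK, fun p => by simp [hf, hk]⟩
  add_mem' := by
    rintro f g ⟨F, hF, hf⟩ ⟨K, hK, hk⟩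
    exact ⟨fun p => F p + K p, hF.add hK, fun p => by simp [hf, hk]⟩
  algebraMap_mem' r := ⟨fun _ => r, contDiffOn_const, fun _ => rfl⟩

variable {O : Opens E}

namespace smoothRing

/-- The element of `smoothRing O` given by a function that is smooth on `O`. -/
def mk (F : E → ℝ) (hF : ContDiffOn ℝ ∞ F O) : smoothRing O := ⟨fun p => F p, F, hF, fun _ => rfl⟩

/-- Evaluation at a point. -/
def eval (p : O) : smoothRing O →+* ℝ := (Pi.evalRingHom _ p).comp (smoothRing O).val.toRingHom

@[simp] lemma eval_mk (F : E → ℝ) (hF : ContDiffOn ℝ ∞ F O) (p : O) : eval p (mk F hF) = F p := rfl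

@[simp] lemma eval_smul (r : ℝ) (f : smoothRing O) (p : O) : eval p (r • f) = r * eval p f := rfl

lemma ext_eval {f g : smoothRing O} (h : ∀ p, eval p f = eval p g) : f = g :=
  Subtype.ext (funext h)

/-- A function on the whole space that extends `f`. -/
def extend (f : smoothRing O) : E → ℝ := f.2.choose

lemma contDiffOn_extend (f : smoothRing O) : ContDiffOn ℝ ∞ (extend f) O := f.2.choose_spec.1

lemma extend_apply (f : smoothRing O) (p : O) : (extend f) p = eval p f := f.2.choose_spec.2 p

lemma differentiableAt_extend (f : smoothRing O) (p : O) : DifferentiableAt ℝ (extend f) p :=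
  ((contDiffOn_extend f).contDiffAt (O.2.mem_nhds p.2)).differentiableAt (by simp)

/-- The directional derivative of a smooth function, as a smooth function. -/
def dirDeriv (v : E) (f : smoothRing O) : smoothRing O :=
  mk (fun p => fderiv ℝ (extend f) p v)
    (((contDiffOn_extend f).fderiv_of_isOpen O.2 (by simp)).clm_apply contDiffOn_const)

/-- A derivative at a point of an open set depends only on values in that set, so the choice made in
`extend` is immaterial. -/
lemma eval_dirDeriv (v : E) {f : smoothRing O} {F : E → ℝ} (h : ∀ p : O, F p = eval p f) (p : O) :
    eval p (dirDeriv v f) = fderiv ℝ F p v := by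
  have : extend f =ᶠ[nhds (p : E)] F := by
    filter_upwards [O.2.mem_nhds p.2] with q hq
    exact (extend_apply f ⟨q, hq⟩).trans (h ⟨q, hq⟩).symm
  rw [dirDeriv, eval_mk, this.fderiv_eq]

/-- The directional derivative as a derivation. -/
def der (v : E) : Derivation ℝ (smoothRing O) (smoothRing O) :=
  Derivation.mk'
    { toFun := dirDeriv v
      map_add' := fun f g => ext_eval fun p => by
        rw [eval_dirDeriv v (F := (extend f) + (extend g)) (fun p => by simp [extend_apply]),
          fderiv_add (differentiableAt_extend f p) (differentiableAt_extend g p)]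
        rfl
      map_smul' := fun r f => ext_eval fun p => by
        rw [eval_dirDeriv v (F := r • (extend f)) (fun p => by simp [extend_apply]),
          fderiv_const_smul (differentiableAt_extend f p)]
        rfl }
    fun f g => ext_eval fun p => by
      rw [LinearMap.coe_mk, AddHom.coe_mk,
        eval_dirDeriv v (F := (extend f) * (extend g)) (fun p => by simp [extend_apply]),
        fderiv_mul (differentiableAt_extend f p) (differentiableAt_extend g p)]
      simp [extend_apply, dirDeriv]

lemma eval_der (v : E) {f : smoothRing O} {F : E → ℝ} (h : ∀ p : O, F p = eval p f) (p : O) :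
    eval p (der v f) = fderiv ℝ F p v := eval_dirDeriv v h p

lemma der_comm (v w : E) (f : smoothRing O) : der v (der w f) = der w (der v f) := by
  refine ext_eval fun p => ?_
  have hc := (contDiffOn_extend f).contDiffAt (O.2.mem_nhds p.2)
  have hd : DifferentiableAt ℝ (fderiv ℝ (extend f)) p :=
    (hc.fderiv_right (m := 1) (by norm_cast)).differentiableAt (by simp)
  have h (v w : E) : eval p (der v (der w f)) = fderiv ℝ (fderiv ℝ (extend f)) p v w := by
    rw [eval_der v (F := fun q => fderiv ℝ (extend f) q w)
      (fun q => (eval_der w (extend_apply f) q).symm), fderiv_clm_apply hd (by fun_prop)]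
    simp
  rw [h, h]
  exact (hc.isSymmSndFDerivAt (by simpa using WithTop.coe_le_coe.2 (le_top : (2 : ℕ∞) ≤ ⊤))) v w

/-- Applied to $\det g$, this inverts the metric matrix over the ring of smooth functions. -/
lemma isUnit_of_ne_zero {f : smoothRing O} (h : ∀ p, eval p f ≠ 0) : IsUnit f := by
  have hF : ContDiffOn ℝ ∞ (fun p => ((extend f) p)⁻¹) O :=
    (contDiffOn_extend f).inv fun p hp => by rw [extend_apply f ⟨p, hp⟩]; exact h _
  refine IsUnit.of_mul_eq_one (mk _ hF) (ext_eval fun p => ?_)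
  rw [map_mul, eval_mk, extend_apply, mul_inv_cancel₀ (h p), map_one]

/-- The logarithm of the absolute value of a nowhere vanishing smooth function. -/
def log (f : smoothRing O) (h : ∀ p, eval p f ≠ 0) : smoothRing O :=
  mk (fun p => Real.log ((extend f) p))
    ((contDiffOn_extend f).log fun p hp => by rw [extend_apply f ⟨p, hp⟩]; exact h _)

@[simp] lemma eval_log (f : smoothRing O) (h : ∀ p, eval p f ≠ 0) (p : O) :
    eval p (log f h) = Real.log (eval p f) := by rw [log, eval_mk, extend_apply]

lemma mul_der_log (v : E) (f : smoothRing O) (h : ∀ p, eval p f ≠ 0) :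
    f * der v (log f h) = der v f := by
  refine ext_eval fun p => ?_
  have h0 : extend f p ≠ 0 := by rw [extend_apply]; exact h p
  rw [map_mul, eval_der v (F := fun p => Real.log ((extend f) p)) (fun p => by simp [extend_apply]),
    eval_der v (extend_apply f), fderiv.log (differentiableAt_extend f p) h0, ← extend_apply]
  simp [h0]

end smoothRing

end SmoothRing

/-! ### Time dependent tensor calculus in a chart -/

section Chart

open TopologicalSpace smoothRing

variable {n : ℕ} {U : Opens (Model n)}

/-- All times and all coordinates in `U`. -/
def slab (U : Opens (Model n)) : Opens (ℝ × Model n) :=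
  ⟨Set.univ ×ˢ U, isOpen_univ.prod U.2⟩

/-- The point of the slab with given time and coordinates. -/
def slab.mk (t : ℝ) (y : U) : slab U := ⟨(t, y), Set.mem_univ _, y.2⟩

/-- The coordinate derivations. -/
def spaceDer (U : Opens (Model n)) (i : Fin n) :
    Derivation ℝ (smoothRing (slab U)) (smoothRing (slab U)) :=
  der (0, EuclideanSpace.single i 1)

/-- The time derivation. -/
def timeDer (U : Opens (Model n)) :
    Derivation ℝ (smoothRing (slab U)) (smoothRing (slab U)) :=
  der (1, 0)

lemma hasDerivAt_timeDer (f : smoothRing (slab U)) (t : ℝ) (y : U) :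
    HasDerivAt (fun s => eval (slab.mk s y) f) (eval (slab.mk t y) (timeDer U f)) t := by
  have h := (differentiableAt_extend f (slab.mk t y)).hasFDerivAt.comp_hasDerivAt t
    ((hasDerivAt_id t).prodMk (hasDerivAt_const t (y : Model n)))
  rw [timeDer, eval_der _ (extend_apply f)]
  have e : (fun s => eval (slab.mk s y) f) = extend f ∘ fun s => (s, (y : Model n)) :=
    funext fun s => (extend_apply f (slab.mk s y)).symm
  rw [e]
  exact h

/-- The function `u` of the coordinates is the restriction of `f` to the time `t`. -/
def Rep (t : ℝ) (u : Model n → ℝ) (f : smoothRing (slab U)) : Prop :=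
  ∀ y : U, u y = eval (slab.mk t y) f

/-- The matrix function `A` of the coordinates is the restriction of `M` to the time `t`. -/
def RepM (t : ℝ) (A : Model n → Matrix (Fin n) (Fin n) ℝ)
    (M : Matrix (Fin n) (Fin n) (smoothRing (slab U))) : Prop :=
  ∀ a b, Rep t (fun y => A y a b) (M a b)

lemma Rep.partialDeriv {t : ℝ} {u : Model n → ℝ} {f : smoothRing (slab U)} (h : Rep t u f)
    (i : Fin n) : Rep t (partialDeriv i u) (spaceDer U i f) := by
  intro y
  have h1 : u =ᶠ[nhds (y : Model n)] fun z => extend f (t, z) := by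
    filter_upwards [U.2.mem_nhds y.2] with z hz
    exact (h ⟨z, hz⟩).trans (extend_apply f (slab.mk t ⟨z, hz⟩)).symm
  have h2 := (differentiableAt_extend f (slab.mk t y)).hasFDerivAt.comp (y : Model n)
    (hasFDerivAt_prodMk_right t (y : Model n))
  rw [PreScattering.partialDeriv, h1.fderiv_eq, spaceDer, eval_der _ (extend_apply f)]
  have h3 : fderiv ℝ (fun z => extend f (t, z)) (y : Model n) = _ := h2.fderiv
  rw [h3]
  simp

variable {t : ℝ} {A B : Model n → Matrix (Fin n) (Fin n) ℝ}
  {M N : Matrix (Fin n) (Fin n) (smoothRing (slab U))}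

lemma RepM.partialMatrix (h : RepM t A M) (i : Fin n) :
    RepM t (partialMatrix i A) (mder (spaceDer U i) M) := fun a b => (h a b).partialDeriv i

lemma RepM.add (h : RepM t A M) (h' : RepM t B N) : RepM t (fun y => A y + B y) (M + N) :=
  fun a b y => by simp [← h a b y, ← h' a b y]

lemma RepM.sub (h : RepM t A M) (h' : RepM t B N) : RepM t (fun y => A y - B y) (M - N) :=
  fun a b y => by simp [← h a b y, ← h' a b y]

lemma RepM.mul (h : RepM t A M) (h' : RepM t B N) : RepM t (fun y => A y * B y) (M * N) :=
  fun a b y => by simp [Matrix.mul_apply, ← h _ _ y, ← h' _ _ y]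

lemma RepM.bracket (h : RepM t A M) (h' : RepM t B N) :
    RepM t (fun y => ⁅A y, B y⁆) (M * N - N * M) := by
  simpa only [Ring.lie_def] using (h.mul h').sub (h'.mul h)

lemma RepM.map_eq (h : RepM t A M) (y : U) : A y = M.map (eval (slab.mk t y)) := by
  ext a b; exact h a b y

lemma RepM.inv (h : RepM t A M) (hMN : M * N = 1) : RepM t (fun y => (A y)⁻¹) N := by
  intro a b y
  have h1 : A y * N.map (eval (slab.mk t y)) = 1 := by
    rw [h.map_eq y, ← Matrix.map_mul, hMN, Matrix.map_one _ (map_zero _) (map_one _)]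
  simp only [Matrix.inv_eq_right_inv h1]
  rfl

lemma RepM.christoffel (h : RepM t A M) (hMN : M * N = 1) (i : Fin n) :
    RepM t (christoffel A i) (leviCivita (spaceDer U) M N i) := by
  intro k j y
  simp only [PreScattering.christoffel, leviCivita, Matrix.of_apply, eval_smul, map_sum, map_mul,
    map_add, map_sub]
  simp only [← ((h _ _).partialDeriv _) y, ← h.inv hMN _ _ y]

section Variation

variable (D : Variation (smoothRing (slab U)) (Fin n)) {G : Model n → Matrix (Fin n) (Fin n) ℝ}

lemma RepM.christoffel' (hpar : D.par = spaceDer U)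
    (hΓ : D.Γ = leviCivita D.par D.G D.Gi) (hG : RepM t G D.G)
    (i : Fin n) : RepM t (PreScattering.christoffel G i) (D.Γ i) := by
  rw [hΓ, hpar]; exact hG.christoffel D.G_mul_Gi i

lemma RepM.covEnd (hpar : D.par = spaceDer U)
    (hΓ : D.Γ = leviCivita D.par D.G D.Gi) (hG : RepM t G D.G)
    (hA : RepM t A M) (i : Fin n) : RepM t (covEnd G i A) (D.cov i M) := by
  have h := (hA.partialMatrix i).add ((RepM.christoffel' D hpar hΓ hG i).bracket hA)
  rw [Variation.cov, hpar]
  exact h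

lemma RepM.curvature (hpar : D.par = spaceDer U)
    (hΓ : D.Γ = leviCivita D.par D.G D.Gi) (hG : RepM t G D.G)
    (i j : Fin n) : RepM t (curvature G i j) (D.curv i j) := by
  have h (i : Fin n) := RepM.christoffel' D hpar hΓ hG i
  have := (((h j).partialMatrix i).sub ((h i).partialMatrix j)).add ((h i).bracket (h j))
  rw [Variation.curv, hpar]
  exact this

lemma RepM.bakryEmeryRicci (hpar : D.par = spaceDer U)
    (hΓ : D.Γ = leviCivita D.par D.G D.Gi) (hG : RepM t G D.G)
    {w : Model n → ℝ} (hf : Rep t (logDensity G w) D.f) :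
    RepM t (bakryEmeryRicci G w) (D.ric + D.hess) := by
  refine RepM.add ?_ ?_
  · intro j k y
    simp only [ricci, Variation.ric, Matrix.of_apply, map_sum]
    exact Finset.sum_congr rfl fun i _ => RepM.curvature D hpar hΓ hG i j i k y
  · intro i j y
    simp only [hessian, Variation.hess, Matrix.of_apply, map_sum, map_sub, map_mul, hpar]
    rw [← (hf.partialDeriv j).partialDeriv i y]
    simp only [← (hf.partialDeriv _) y, ← RepM.christoffel' D hpar hΓ hG _ _ _ y]

lemma RepM.extCovDeriv (hpar : D.par = spaceDer U)
    (hΓ : D.Γ = leviCivita D.par D.G D.Gi) (hG : RepM t G D.G)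
    (hA : RepM t A M) (y : U) (i j k : Fin n) :
    extCovDeriv G A y i j k = eval (slab.mk t y) (D.ext M i j k) := by
  have h (i : Fin n) := RepM.covEnd D hpar hΓ hG hA i
  simp only [PreScattering.extCovDeriv, Variation.ext, map_sub, ← h _ _ _ y]

lemma RepM.extCovDeriv_ber (hpar : D.par = spaceDer U)
    (hΓ : D.Γ = leviCivita D.par D.G D.Gi) (hG : RepM t G D.G)
    {w : Model n → ℝ} (hf : Rep t (logDensity G w) D.f) (y : U)
    (i j k : Fin n) :
    PreScattering.extCovDeriv G (raise G (PreScattering.bakryEmeryRicci G w)) y i j k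
      = eval (slab.mk t y) (D.ext D.ber i j k) :=
  RepM.extCovDeriv D hpar hΓ hG
    ((hG.inv D.G_mul_Gi).mul (RepM.bakryEmeryRicci D hpar hΓ hG hf)) y i j k

end Variation

/-- Conservation of the pre-scattering condition in a chart. -/
theorem chart_conservation (G V : ℝ → Model n → Matrix (Fin n) (Fin n) ℝ) (w : Model n → ℝ)
    (hG : ∀ i j, ContDiffOn ℝ ∞ (fun p : ℝ × Model n => G p.1 p.2 i j) (Set.univ ×ˢ (U : Set _)))
    (hw : ContDiffOn ℝ ∞ w U) (hw0 : ∀ y ∈ U, w y ≠ 0)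
    (hsymm : ∀ t, ∀ y ∈ U, ∀ i j, G t y i j = G t y j i)
    (hdet : ∀ t, ∀ y ∈ U, 0 < (G t y).det)
    (hV : ∀ t, ∀ y ∈ U, ∀ i j, HasDerivAt (fun s => G s y i j) (V t y i j) t)
    (hF : ∀ t, ∀ y ∈ U, ∀ i j, extCovDeriv (G t) (raise (G t) (V t)) y i j = 0)
    (hE : ∀ t, ∀ y ∈ U, ∀ i j, ⁅curvature (G t) i j y, raise (G t) (V t) y⁆ = 0)
    (hE' : ∀ t, ∀ y ∈ U, ∀ i j k,
      ⁅curvature (G t) i j y, covEnd (G t) k (raise (G t) (V t)) y⁆ = 0)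
    (h0 : ∀ y ∈ U, ∀ i j, extCovDeriv (G 0) (raise (G 0) (bakryEmeryRicci (G 0) w)) y i j = 0)
    (t : ℝ) (y : Model n) (hy : y ∈ U) (i j : Fin n) :
    extCovDeriv (G t) (raise (G t) (bakryEmeryRicci (G t) w)) y i j = 0 := by
  let O := slab U
  let GS : Matrix (Fin n) (Fin n) (smoothRing O) := Matrix.of fun i j =>
    smoothRing.mk (O := O) (fun p : ℝ × Model n => G p.1 p.2 i j) (hG i j)
  have hrep (t : ℝ) : RepM t (G t) GS := fun _ _ _ => rfl
  have hsplit (p : O) : ∃ t y, p = slab.mk t y := ⟨p.1.1, ⟨p.1.2, p.2.2⟩, rfl⟩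
  have hdetS (t : ℝ) (y : U) : eval (slab.mk t y) GS.det = (G t y).det := by
    rw [(hrep t).map_eq y]; exact RingHom.map_det (eval (slab.mk t y)) GS
  have hdet0 (p : O) : eval p GS.det ≠ 0 := by
    obtain ⟨t, y, rfl⟩ := hsplit p
    rw [hdetS]; exact (hdet t y y.2).ne'
  have hunit : IsUnit GS.det := isUnit_of_ne_zero hdet0
  have hinv : GS * GS⁻¹ = 1 := Matrix.mul_nonsing_inv _ hunit
  have hGsymm : GS.transpose = GS := by
    refine Matrix.ext fun a b => ext_eval fun p => ?_
    obtain ⟨t, y, rfl⟩ := hsplit p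
    exact hsymm t y y.2 b a
  let wS : smoothRing O := smoothRing.mk (fun p => w p.2) (hw.comp contDiffOn_snd fun p hp => hp.2)
  have hwS (p : O) : eval p wS ≠ 0 := hw0 _ p.2.2
  have hdtw : timeDer U (log wS hwS) = 0 := by
    refine ext_eval fun p => ?_
    obtain ⟨t, y, rfl⟩ := hsplit p
    have h1 := hasDerivAt_timeDer (log wS hwS) t y
    simp only [eval_log] at h1
    exact h1.unique (hasDerivAt_const t (Real.log (w y)))
  let HS : Matrix (Fin n) (Fin n) (smoothRing O) := GS⁻¹ * mder (timeDer U) GS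
  have hdtG : mder (timeDer U) GS = GS * HS := by rw [← mul_assoc, hinv, one_mul]
  -- This represents $\log(\sqrt{\det g}/|w|)$: `Real.log` ignores signs, so $w$ needs no absolute
  -- value. The $w$ term is constant in time, and Jacobi's formula gives $2\dot f = \mathrm{tr}\,H$.
  let fS : smoothRing O := (1 / 2 : ℝ) • log GS.det hdet0 - log wS hwS
  have hdtf : timeDer U fS + timeDer U fS = HS.trace := by
    have h1 : GS.det * timeDer U (log GS.det hdet0) = GS.det * HS.trace := by
      rw [← derivation_det (timeDer U) hdtG]; exact mul_der_log _ _ hdet0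
    have h2 := hunit.mul_left_cancel h1
    simp only [fS, map_sub, hdtw, sub_zero, Derivation.map_smul, ← add_smul, h2]
    norm_num
  let D : Variation (smoothRing O) (Fin n) :=
    { par := spaceDer U
      dt := timeDer U
      par_comm := fun i j a => der_comm _ _ a
      dt_comm := fun i a => der_comm _ _ a
      G := GS
      Gi := GS⁻¹
      G_symm := hGsymm
      G_mul_Gi := hinv
      Γ := leviCivita (spaceDer U) GS GS⁻¹
      torsion := leviCivita_torsion hGsymm
      compat := leviCivita_compat hGsymm hinv
      H := HS
      dt_G := hdtG
      f := fS
      dt_f := hdtf }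
  have hVrep (t : ℝ) : RepM t (V t) (mder (timeDer U) GS) := fun a b y =>
    (hV t y y.2 a b).unique (hasDerivAt_timeDer (GS a b) t y)
  have hHrep (t : ℝ) : RepM t (raise (G t) (V t)) D.H := ((hrep t).inv hinv).mul (hVrep t)
  have hfrep (t : ℝ) : Rep t (logDensity (G t) w) D.f := by
    intro y
    have hd := hdet t y y.2
    have hwy := hw0 y y.2
    change _ = eval (slab.mk t y) ((1 / 2 : ℝ) • log GS.det hdet0 - log wS hwS)
    rw [map_sub, eval_smul, eval_log, eval_log, hdetS, logDensity,
      Real.log_div (Real.sqrt_pos.2 hd).ne' (abs_pos.2 hwy).ne', Real.log_sqrt hd.le, Real.log_abs]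
    change _ = 1 / 2 * Real.log (G t y).det - Real.log (w y)
    ring
  have hFD : D.InF := by
    intro i j k
    refine ext_eval fun p => ?_
    obtain ⟨t, y, rfl⟩ := hsplit p
    have h1 := RepM.extCovDeriv D rfl rfl (hrep t) (hHrep t) y i j k
    rw [hF t y y.2, Variation.ext, map_sub] at h1
    exact sub_eq_zero.mp h1.symm
  have hED : D.InE := by
    intro i j
    rw [← sub_eq_zero]
    refine Matrix.ext fun a b => ext_eval fun p => ?_
    obtain ⟨t, y, rfl⟩ := hsplit p
    have h1 := (RepM.curvature D rfl rfl (hrep t) i j).bracket (hHrep t) a b y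
    simp only [hE t y y.2] at h1
    rw [← h1]; simp
  have hED' : D.InE' := by
    intro i j k
    rw [← sub_eq_zero]
    refine Matrix.ext fun a b => ext_eval fun p => ?_
    obtain ⟨t, y, rfl⟩ := hsplit p
    have h1 := (RepM.curvature D rfl rfl (hrep t) i j).bracket
      (RepM.covEnd D rfl rfl (hrep t) (hHrep t) k) a b y
    simp only [hE' t y y.2] at h1
    rw [← h1]; simp
  let T (t : ℝ) (k : Fin n) : ℝ := eval (slab.mk t ⟨y, hy⟩) (D.ext D.ber i j k)
  have hT (t : ℝ) (k : Fin n) :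
      extCovDeriv (G t) (raise (G t) (bakryEmeryRicci (G t) w)) y i j k = T t k :=
    RepM.extCovDeriv_ber D rfl rfl (hrep t) (hfrep t) ⟨y, hy⟩ i j k
  have hT0 : T 0 = 0 := funext fun k => by rw [← hT, h0 y hy]
  -- The lowered tensor has zero time derivative and vanishes at time $0$; invertibility of $g$ then
  -- gives $T = 0$.
  have hconst (a : Fin n) : ((G t y).mulVec (T t)) a = 0 := by
    let s := ∑ b, D.G a b * D.ext D.ber i j b
    have hs (r : ℝ) : eval (slab.mk r ⟨y, hy⟩) s = ((G r y).mulVec (T r)) a := by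
      simp only [s, map_sum, map_mul]; rfl
    have hd (r : ℝ) : HasDerivAt (fun r => eval (slab.mk r ⟨y, hy⟩) s) 0 r := by
      have := hasDerivAt_timeDer s r ⟨y, hy⟩
      rwa [show timeDer U s = 0 from Variation.dt_sum_G_ext_ber hFD hED hED' i j a,
        map_zero] at this
    have hc := is_const_of_deriv_eq_zero (fun r => (hd r).differentiableAt)
      (fun r => (hd r).deriv) t 0
    rw [← hs, hc, hs, hT0, Matrix.mulVec_zero, Pi.zero_apply]
  have hTt : T t = 0 := Matrix.eq_zero_of_mulVec_eq_zero (hdet t y hy).ne' (funext hconst)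
  exact funext fun k => by rw [hT, hTt]

end Chart

/-! ### Coordinate frames -/

section Manifold

variable {n : ℕ} {X : Type*} [TopologicalSpace X] [ChartedSpace (Model n) X]
  {e : OpenPartialHomeomorph X (Model n)}

lemma mdifferentiable_of_mem_charts (he : e ∈ charts X) : e.MDifferentiable (𝓡 n) (𝓡 n) :=
  ⟨(contMDiffOn_of_mem_maximalAtlas he).mdifferentiableOn (by simp),
    (contMDiffOn_symm_of_mem_maximalAtlas he).mdifferentiableOn (by simp)⟩

/-- The basis of coordinate vector fields. -/
def frameBasis (he : e ∈ charts X) {y : Model n} (hy : y ∈ e.target) :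
    Module.Basis (Fin n) ℝ (TangentSpace (𝓡 n) (e.symm y)) :=
  (EuclideanSpace.basisFun (Fin n) ℝ).toBasis.map
    ((mdifferentiable_of_mem_charts he).symm.mfderiv hy).toLinearEquiv

lemma frameBasis_apply (he : e ∈ charts X) {y : Model n} (hy : y ∈ e.target) (i : Fin n) :
    frameBasis he hy i = frame e y i := by
  have h : (EuclideanSpace.basisFun (Fin n) ℝ).toBasis i
      = (EuclideanSpace.single i (1 : ℝ) : Model n) := by
    rw [OrthonormalBasis.coe_toBasis, EuclideanSpace.basisFun_apply]
  exact congrArg (mfderiv (𝓡 n) (𝓡 n) e.symm y) h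

/-- A top-degree form is its value on a basis times the determinant of that basis, so vanishing on
the frame would make it zero. -/
lemma component_ne_zero (Ω : VolumeForm (n := n) X) (he : e ∈ charts X) {y : Model n}
    (hy : y ∈ e.target) : Ω.component e y ≠ 0 := by
  intro h
  refine Ω.ne_zero (e.symm y) (ContinuousAlternatingMap.toAlternatingMap_injective ?_)
  refine (AlternatingMap.eq_smul_basis_det (frameBasis he hy) _).trans ?_
  have : (fun i => frameBasis he hy i) = frame e y := funext (frameBasis_apply he hy)
  rw [show (⇑(frameBasis he hy)) = frame e y from this]
  simp only [VolumeForm.component] at h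
  simp [h]

variable [IsManifold (𝓡 n) ∞ X]

lemma metricMatrix_symm (g : Metric (n := n) X) (e : OpenPartialHomeomorph X (Model n))
    (y : Model n) (i j : Fin n) : metricMatrix g e y i j = metricMatrix g e y j i :=
  g.symm _ _ _

/-- This is the Gram matrix of the coordinate frame, which is a basis. It supplies the positive
determinant needed for the inverse and the logarithm. -/
lemma metricMatrix_posDef (g : Metric (n := n) X) (he : e ∈ charts X) {y : Model n}
    (hy : y ∈ e.target) : (metricMatrix g e y).PosDef := by
  refine Matrix.PosDef.of_dotProduct_mulVec_pos ?_ fun c hc => ?_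
  · ext i j; exact metricMatrix_symm g e y j i
  · set u := ∑ i, c i • frame e y i with hu
    have hu0 : u ≠ 0 := by
      intro h
      refine hc (funext fun i => ?_)
      refine Fintype.linearIndependent_iff.mp (frameBasis he hy).linearIndependent c ?_ i
      simpa only [frameBasis_apply] using h
    have h := g.pos _ u hu0
    have h2 : g.inner (e.symm y) u u = star c ⬝ᵥ (metricMatrix g e y).mulVec c := by
      simp only [hu, map_sum, map_smul, sum_apply,
        smul_apply, dotProduct, Matrix.mulVec, metricMatrix, components,
        Matrix.of_apply, smul_eq_mul, Finset.mul_sum, star_trivial]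
      refine Finset.sum_congr rfl fun a _ => Finset.sum_congr rfl fun b _ => ?_
      rw [g.symm _ (frame e y b) (frame e y a), mul_comm (c b)]
    rwa [h2] at h

end Manifold

end PreScattering

end

open PreScattering
theorem mainTheorem3 {n : ℕ} {X : Type*} [TopologicalSpace X] [ChartedSpace (Model n) X]
    [IsManifold (𝓡 n) ∞ X] (Ω : VolumeForm (n := n) X)
    (g : ℝ → PreScattering.Metric (n := n) X) (hg : IsSmoothFamily g)
    (gdot : ℝ → SymForm (n := n) X) (hgdot : IsVariation g gdot)
    (hFE : ∀ t : ℝ, gdot t ∈ spaceF (g t) ∩ spaceE (g t))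
    (h0 : g 0 ∈ preScattering Ω) :
    ∀ t : ℝ, g t ∈ preScattering Ω := by
  intro t e he y hy i j
  exact chart_conservation (U := ⟨e.target, e.open_target⟩) (fun t => metricMatrix (g t) e)
    (fun t => components (gdot t).form e) (Ω.component e) (hg e he) (Ω.smooth e he)
    (fun y hy => component_ne_zero Ω he hy) (fun t y _ => metricMatrix_symm (g t) e y)
    (fun t y hy => (metricMatrix_posDef (g t) he hy).det_pos)
    (fun t y _ i j => hgdot t _ _ _)
    (fun t y hy i j => (hFE t).1 e he y hy i j)
    (fun t y hy i j => ((hFE t).2 e he y hy i j).1)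
    (fun t y hy i j k => ((hFE t).2 e he y hy i j).2 k)
    (fun y hy i j => h0 e he y hy i j) t y hy i j
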